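/- Let $q=p^m\equiv 5 \pmod 8$ with $p$ prime, and let $q=s^2+4t^2$ be its proper representation, i.e. $s,t\in\mathbb Z$, $\gcd(q,s)=1$, $s\equiv 1\pmod 4$ (the sign of $t$ is free). Let $\alpha$ be a generator of $\mathbb F_q^*$. For $0\le i\le 3$ let $C_i=\alpha^i\langle\alpha^4\rangle$ be the quartic cyclotomic classes, and put $$(0,3)=|(C_0+1)\cap C_3|,\qquad t(\alpha)=\frac{16\,(0,3)-q-1-2s}{8}.$$ Let $G$ be a finite abelian group and $\mathbb Z[G]$ its group ring; write $e$ for the identity of $G$, also for the unit of $\mathbb Z[G]$, and $G$ also for the element $\sum_{g\in G}g$ of $\mathbb Z[G]$. For a $\{0,1\}$-array $\boldsymbol a=(a_g)_{g\in G}$ let $A=\sum_g a_g g$, $A^{(-1)}=\sum_g a_g g^{-1}$ and $|A|=\sum_g|a_g|$ (and likewise $B$ for $\boldsymbol b$). The array $\boldsymbol a$ is \emph{symmetric} if $A=A^{(-1)}$ and \emph{skew-symmetric} if $A+A^{(-1)}=G+e$ or $A+A^{(-1)}=G-e$. A pair $(\boldsymbol a,\boldsymbol b)$ of $\{0,1\}$-arrays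 indexed by $G$ is a \emph{Legendre pair} if $|A|=|B|$ and either $|A|=\frac{|G|+1}{2}$ and $AA^{(-1)}+BB^{(-1)}=2\cdot\frac{|G|+1}{2}\,e+\frac{|G|+1}{2}(G-e)$, or $|A|=\frac{|G|-1}{2}$ and $AA^{(-1)}+BB^{(-1)}=2\cdot\frac{|G|-1}{2}\,e+\frac{|G|-3}{2}(G-e)$. A Legendre pair is a \emph{Yamada–Pott pair} if one of its two arrays is symmetric and the other is skew-symmetric. Take $G$ to be the additive group of $\mathbb F_q$ (so $G\cong\mathbb Z_p^m$), and for $i=1,2$ let $(\boldsymbol a_i,\boldsymbol b_i)$ be the pair of $\{0,1\}$-arrays indexed by $G$ that are the indicator functions of $(A_i,B_i)$, where $$(A_1,B_1)=(C_0\cup C_1,\;C_1\cup C_3),\qquad (A_2,B_2)=(C_0\cup C_2,\;C_2\cup C_3).$$ \textbf{Theorem.} For $i=1,2$, $(\boldsymbol a_i,\boldsymbol b_i)$ is a Yamada–Pott pair if and only if $t(\alpha)=(-1)^{i+1}$. Hence, if $t^2=1$ (i.e. $q=s^2+4$), exactly one of the two pairs is a Yamada–Pott pair. Moreover, in each pair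 one array is symmetric and the other is skew-symmetric: $\boldsymbol a_1$ and $\boldsymbol b_2$ are skew-symmetric, and $\boldsymbol b_1$ and $\boldsymbol a_2$ are symmetric. -/

import Mathlib

noncomputable section

namespace ArrayPairs

section GroupRing

variable {G : Type*} [AddCommGroup G] [Fintype G]

/-- The element `∑ g, a g • g` of the group ring `ℤ[G]` corresponding to the array `a`. The finite
abelian group `G` is written additively, so that the group element `g` is `single g 1`. -/
def ofArray (a : G → ℤ) : AddMonoidAlgebra ℤ G :=
  ∑ g : G, AddMonoidAlgebra.single g (a g)

/-- `W ^ (-1) = ∑ g, a g • g⁻¹` for `W = ∑ g, a g • g`; the inverse of `g` is `-g` here. -/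
def conj (W : AddMonoidAlgebra ℤ G) : AddMonoidAlgebra ℤ G :=
  AddMonoidAlgebra.mapDomain (fun g : G => -g) W

/-- `|W| = ∑ g, |a g|` for `W = ∑ g, a g • g`. -/
def weight (W : AddMonoidAlgebra ℤ G) : ℤ :=
  ∑ g : G, |W.coeff g|

variable (G) in
/-- The group `G` as an element of its group ring, `∑ g, g`. -/
def groupSum : AddMonoidAlgebra ℤ G :=
  ofArray (fun _ : G => (1 : ℤ))

/-- A `{0,1}` array indexed by `G`. -/
def IsZeroOne (a : G → ℤ) : Prop :=
  ∀ g, a g = 0 ∨ a g = 1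

/-- A symmetric array: `M = M ^ (-1)`. -/
def IsSymmetric (a : G → ℤ) : Prop :=
  ofArray a = conj (ofArray a)

/-- A skew-symmetric array: `M + M ^ (-1) = G + e` or `M + M ^ (-1) = G - e`, where the identity
`e` of `G` is the unit of the group ring. -/
def IsSkewSymmetric (a : G → ℤ) : Prop :=
  ofArray a + conj (ofArray a) = groupSum G + 1 ∨
    ofArray a + conj (ofArray a) = groupSum G - 1

/-- A Legendre `{0,1}` array pair. The integer divisions are exact, because in either case
`|G|` is odd. -/
def IsLegendrePair (a b : G → ℤ) : Prop :=
  IsZeroOne a ∧ IsZeroOne b ∧ ∑ g, a g = ∑ g, b g ∧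
    ((2 * ∑ g, a g = (Fintype.card G : ℤ) + 1 ∧
        ofArray a * conj (ofArray a) + ofArray b * conj (ofArray b) =
          (2 * (((Fintype.card G : ℤ) + 1) / 2)) • (1 : AddMonoidAlgebra ℤ G) +
            (((Fintype.card G : ℤ) + 1) / 2) • (groupSum G - 1)) ∨
      (2 * ∑ g, a g = (Fintype.card G : ℤ) - 1 ∧
        ofArray a * conj (ofArray a) + ofArray b * conj (ofArray b) =
          (2 * (((Fintype.card G : ℤ) - 1) / 2)) • (1 : AddMonoidAlgebra ℤ G) +
            (((Fintype.card G : ℤ) - 3) / 2) • (groupSum G - 1)))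

/-- A Yamada–Pott `{0,1}` array pair: a Legendre pair with `|A| = |B|`, one of whose members is
symmetric while the other one is skew-symmetric. -/
def IsYamadaPottPair (a b : G → ℤ) : Prop :=
  IsLegendrePair a b ∧ weight (ofArray a) = weight (ofArray b) ∧
    ((IsSymmetric a ∧ IsSkewSymmetric b) ∨ (IsSymmetric b ∧ IsSkewSymmetric a))

/-- The `{0,1}` array whose set of `1` indices is `D`. -/
def arrayOf (D : Set G) : G → ℤ :=
  D.indicator (fun _ => 1)

end GroupRing

section Cyclotomy

variable {F : Type*} [Field F]

/-- The cyclotomic class `C_i = α ^ i ⟨α ^ d⟩` of order `d`, as a set of field elements. -/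
def cyclotomicClass (d : ℕ) (α : Fˣ) (i : ℕ) : Set F :=
  {x | ∃ u ∈ Subgroup.zpowers (α ^ d), x = ((α ^ i * u : Fˣ) : F)}

/-- The cyclotomic number `(i, j) = |(C_i + 1) ∩ C_j|` of order `d`. -/
def cyclotomicNumber (d : ℕ) (α : Fˣ) (i j : ℕ) : ℕ :=
  (((fun x : F => x + 1) '' cyclotomicClass d α i) ∩ cyclotomicClass d α j).ncard

/-- The rational number `t(α) = (16 (0,3) - q - 1 - 2 s) / 8`, with `q = |F|` and the cyclotomic
number `(0,3)` of order `4`. -/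
def tOf (α : Fˣ) (s : ℤ) : ℚ :=
  (16 * (cyclotomicNumber 4 α 0 3 : ℚ) - (Nat.card F : ℚ) - 1 - 2 * (s : ℚ)) / 8

end Cyclotomy

end ArrayPairs

end

/-! Let `χ` be the quartic character with values in `ℤ[i]` and `χ α = i`, and let `η = χ ^ 2` be the
quadratic character. As `q ≡ 5 (mod 8)`, `χ (-1) = -1`, so `ψ = re χ + im χ` is odd while `η` is
even. Off `0` the four arrays are `(1 ± ψ) / 2` and `(1 ± η) / 2`, which gives their symmetry types.
At a shift `g ≠ 0` the autocorrelation of `η` is `-1` and that of `ψ` is `η g * im S - 1`, where `S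
= ∑ x, χ x * χ (x + 1)` is `shiftSum χ`. The Legendre condition thus becomes `im S = -2` for the
first pair and `im S = 2` for the second (`isYamadaPottPair_pair_iff`).

Expanding the indicators of `C₀` and `C₃` in `χ` and `η` gives `16 (0,3) = q + 1 + 2 re S - 4 im S`
(`sixteen_mul_cyclotomicNumber`), hence `t(α) = -im S / 2` as soon as `re S = s` (`re_shiftSum_eq`).
The latter holds because `|S| ^ 2 = q`, because `p` does not divide `re S` (modulo `p`, `2 re S` is
a middle binomial coefficient, see `not_dvd_re_shiftSum`), because proper representations of a prime
power are unique up to signs (`sq_eq_sq_of_prime_pow`), and because the formula for `(0,3)` forces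
`re S ≡ 1 (mod 4)`. If `t ^ 2 = 1`, the norm equation leaves `im S = ± 2`. -/

namespace ArrayPairs

/-! ### Coefficients in the group ring and the Legendre condition. -/

section GroupRing

variable {G : Type*}

lemma coeff_ofArray [Fintype G] (a : G → ℤ) (g : G) : (ofArray a).coeff g = a g := by
  classical
  simp [ofArray, AddMonoidAlgebra.coeff_sum, Finsupp.single_apply]

lemma ext_coeff {V W : AddMonoidAlgebra ℤ G} : V = W ↔ ∀ g, V.coeff g = W.coeff g := by
  refine ⟨fun h => by simp [h], fun h => ?_⟩
  ext g
  exact h g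

lemma coeff_groupSum [Fintype G] (g : G) : (groupSum G).coeff g = 1 := coeff_ofArray _ g

lemma weight_ofArray_of_isZeroOne [Fintype G] {a : G → ℤ} (ha : IsZeroOne a) :
    weight (ofArray a) = ∑ g, a g := by
  refine Finset.sum_congr rfl fun g _ => ?_
  rw [coeff_ofArray]
  rcases ha g with h | h <;> simp [h]

variable [AddCommGroup G]

lemma coeff_one [DecidableEq G] (g : G) :
    (1 : AddMonoidAlgebra ℤ G).coeff g = if g = 0 then 1 else 0 := by
  simp [AddMonoidAlgebra.one_def, Finsupp.single_apply, eq_comm]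

variable [Fintype G]

lemma conj_ofArray (a : G → ℤ) : conj (ofArray a) = ofArray fun g => a (-g) := by
  rw [ext_coeff]
  intro g
  rw [coeff_ofArray, ← coeff_ofArray a (-g)]
  conv_lhs => rw [← neg_neg g]
  exact Finsupp.mapDomain_apply neg_injective _ _

lemma coeff_ofArray_mul (a b : G → ℤ) (g : G) :
    (ofArray a * ofArray b).coeff g = ∑ x, a x * b (g - x) := by
  classical
  simp only [ofArray, Finset.sum_mul_sum, AddMonoidAlgebra.single_mul_single,
    AddMonoidAlgebra.coeff_sum, Finsupp.finsetSum_apply, AddMonoidAlgebra.coeff_single,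
    Finsupp.single_apply]
  refine Finset.sum_congr rfl fun x _ => ?_
  rw [Finset.sum_eq_single (g - x)]
  · simp
  · intro y _ hy
    rw [if_neg]
    rintro rfl
    simp at hy
  · simp

lemma coeff_ofArray_mul_conj (a : G → ℤ) (g : G) :
    (ofArray a * conj (ofArray a)).coeff g = ∑ x, a x * a (x + g) := by
  rw [conj_ofArray, coeff_ofArray_mul]
  refine Fintype.sum_equiv (Equiv.subRight g) _ _ fun x => ?_
  simp [mul_comm]

lemma isSymmetric_iff (a : G → ℤ) : IsSymmetric a ↔ ∀ g, a (-g) = a g := by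
  simp only [IsSymmetric, ext_coeff, conj_ofArray, coeff_ofArray, eq_comm]

lemma isSkewSymmetric_of_add_neg [DecidableEq G] {a : G → ℤ}
    (h : ∀ g, a g + a (-g) = if g = 0 then 0 else 1) : IsSkewSymmetric a := by
  right
  rw [ext_coeff]
  intro g
  simp only [conj_ofArray, AddMonoidAlgebra.coeff_add, AddMonoidAlgebra.coeff_sub,
    Finsupp.add_apply, Finsupp.sub_apply, coeff_ofArray, coeff_groupSum, coeff_one, h]
  split_ifs <;> simp

/-- The weight rules out the first alternative, and the coefficient at `0` is automatic since `a ^ 2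
= a`; only nonzero shifts carry a condition. -/
lemma isLegendrePair_iff {a b : G → ℤ} (ha : IsZeroOne a) (hb : IsZeroOne b)
    (hA : 2 * ∑ g, a g = (Fintype.card G : ℤ) - 1) (hB : 2 * ∑ g, b g = (Fintype.card G : ℤ) - 1) :
    IsLegendrePair a b ↔ ∀ g, g ≠ 0 →
      2 * (∑ x, a x * a (x + g) + ∑ x, b x * b (x + g)) = (Fintype.card G : ℤ) - 3 := by
  classical
  have hsq : ∀ {c : G → ℤ}, IsZeroOne c → ∑ x, c x * c (x + 0) = ∑ x, c x := fun hc =>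
    Finset.sum_congr rfl fun x _ => by rcases hc x with h | h <;> simp [h]
  have hAB : ∑ g, a g = ∑ g, b g := by omega
  unfold IsLegendrePair
  simp only [ha, hb, hAB, true_and, ext_coeff, AddMonoidAlgebra.coeff_add,
    AddMonoidAlgebra.coeff_sub, AddMonoidAlgebra.coeff_smul,
    Finsupp.add_apply, Finsupp.sub_apply, Finsupp.smul_apply, coeff_groupSum, coeff_one,
    coeff_ofArray_mul_conj, smul_eq_mul, hB]
  constructor
  · rintro (h | h) g hg
    · omega
    · rw [h g]
      simp only [hg, if_false]
      omega
  · intro h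
    refine Or.inr fun g => ?_
    by_cases hg : g = 0
    · subst hg
      rw [hsq ha, hsq hb]
      simp only [if_true]
      omega
    · have := h g hg
      simp only [hg, if_false]
      omega

end GroupRing

/-! ### Correlations of multiplicative characters. -/

section CharacterSums

open Finset

variable {F R : Type*} [Field F] [Fintype F] [CommRing R]

lemma sum_mul_comp_add_one (χ φ : MulChar F R) :
    ∑ x, χ x * φ (x + 1) = χ (-1) * jacobiSum χ φ := by
  rw [jacobiSum, Finset.mul_sum]
  refine Fintype.sum_equiv (Equiv.neg F) _ _ fun x => ?_
  simp only [Equiv.neg_apply, ← mul_assoc, ← map_mul, neg_mul_neg, one_mul]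
  congr 2
  ring

lemma sum_mul_comp_add (χ φ : MulChar F R) {g : F} (hg : g ≠ 0) :
    ∑ x, χ x * φ (x + g) = χ g * φ g * ∑ x, χ x * φ (x + 1) := by
  rw [Finset.mul_sum]
  refine (Fintype.sum_equiv (Equiv.mulLeft₀ g hg) _ _ fun x => ?_).symm
  have : g * x + g = g * (x + 1) := by ring
  simp only [Equiv.mulLeft₀_apply, this, map_mul]
  ring

lemma sum_mul_inv_comp_add [IsDomain R] {χ : MulChar F R} (hχ : χ ≠ 1) {g : F} (hg : g ≠ 0) :
    ∑ x, χ x * χ⁻¹ (x + g) = -1 := by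
  have h1 : χ g * χ⁻¹ g = 1 := by
    rw [← MulChar.mul_apply, mul_inv_cancel, MulChar.one_apply hg.isUnit]
  have h2 : χ (-1) * χ (-1) = 1 := by rw [← map_mul]; simp
  rw [sum_mul_comp_add χ χ⁻¹ hg, sum_mul_comp_add_one, jacobiSum_nontrivial_inv hχ, h1, mul_neg, h2,
    one_mul]

/-- The fibre of squaring over `w` has `1 + η w` elements. -/
lemma sum_comp_sq [DecidableEq F] (hF : ringChar F ≠ 2) (f : F → R) :
    ∑ z, f (z ^ 2) = ∑ w, f w * (1 + (quadraticChar F w : R)) := by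
  rw [← Finset.sum_fiberwise Finset.univ (fun z : F => z ^ 2)]
  refine Finset.sum_congr rfl fun w _ => ?_
  have h := quadraticChar_card_sqrts hF w
  have h' : ((#{z : F | z ^ 2 = w} : ℕ) : ℤ) = quadraticChar F w + 1 := by
    rw [← h]
    congr 2
    ext
    simp
  rw [Finset.sum_congr rfl (g := fun _ => f w) (by simp +contextual), Finset.sum_const, nsmul_eq_mul,
    ← Int.cast_natCast, h']
  push_cast
  ring

/-- The autocorrelation of a `{0,1}`-array `a` such that `2 a x = 1 + f x` off `0`. -/
lemma four_mul_sum_mul_comp_add [DecidableEq F] {a f : F → ℤ} (hf : ∑ x, f x = 0) (hf0 : f 0 = 0)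
    (ha : ∀ x, 2 * a x = (if x = 0 then 0 else 1) + f x) {g : F} (hg : g ≠ 0) :
    4 * ∑ x, a x * a (x + g) =
      Fintype.card F - 2 - f g - f (-g) + ∑ x, f x * f (x + g) := by
  have hshift : ∑ x, f (x + g) = 0 := by rw [← hf]; exact Equiv.sum_comp (Equiv.addRight g) f
  -- At `x = 0` and `x = -g` one factor vanishes; the terms `f g` and `f (-g)` cancel what the other
  -- factor would contribute there.
  have key : ∀ x, 4 * (a x * a (x + g)) = 1 - (if x = 0 then 1 else 0) - (if x = -g then 1 else 0)
      + f x + f (x + g) - (if x = 0 then f g else 0) - (if x = -g then f (-g) else 0)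
      + f x * f (x + g) := by
    intro x
    have h1 := ha x
    have h2 := ha (x + g)
    rw [show 4 * (a x * a (x + g)) = (2 * a x) * (2 * a (x + g)) by ring, h1, h2]
    by_cases hx : x = 0
    · subst hx
      simp [hf0, hg]
    · by_cases hx' : x = -g
      · subst hx'
        simp [hf0, hg]
      · have : x + g ≠ 0 := fun h => hx' (eq_neg_of_add_eq_zero_left h)
        simp only [hx, hx', this, if_false]
        ring
  rw [Finset.mul_sum, Finset.sum_congr rfl fun x _ => key x]
  simp only [Finset.sum_add_distrib, Finset.sum_sub_distrib, hf, hshift]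
  simp
  ring

end CharacterSums

/-! ### The quartic character and its Jacobi sum. -/

section QuarticCharacter

open Finset

lemma re_sum {ι : Type*} (s : Finset ι) (f : ι → GaussianInt) :
    (∑ i ∈ s, f i).re = ∑ i ∈ s, (f i).re :=
  map_sum (⟨⟨Zsqrtd.re, rfl⟩, fun _ _ => rfl⟩ : GaussianInt →+ ℤ) f s

lemma im_sum {ι : Type*} (s : Finset ι) (f : ι → GaussianInt) :
    (∑ i ∈ s, f i).im = ∑ i ∈ s, (f i).im :=
  map_sum (⟨⟨Zsqrtd.im, rfl⟩, fun _ _ => rfl⟩ : GaussianInt →+ ℤ) f s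

lemma quarticChar_ne_one {F : Type*} [Field F] {χ : MulChar F GaussianInt} (hneg : χ (-1) = -1) : χ ≠ 1 := by
  rintro rfl
  rw [MulChar.one_apply isUnit_one.neg] at hneg
  exact absurd hneg (by decide)

lemma quarticChar_neg {F : Type*} [Field F] {χ : MulChar F GaussianInt} (hneg : χ (-1) = -1) (x : F) : χ (-x) = -χ x := by
  rw [neg_eq_neg_one_mul x, map_mul, hneg, neg_one_mul]

lemma sum_quarticChar {F : Type*} [Field F] [Fintype F] {χ : MulChar F GaussianInt}
    (hneg : χ (-1) = -1) : ∑ x, χ x = 0 :=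
  MulChar.sum_eq_zero_of_ne_one (quarticChar_ne_one hneg)

lemma ringChar_ne_two_of_card {F : Type*} [Field F] [Fintype F] (hq : Fintype.card F % 8 = 5) :
    ringChar F ≠ 2 := fun h => by
  have := FiniteField.even_card_of_char_two h
  omega

variable {F : Type*} [Field F] [Fintype F]

/-- The sum `∑ x, χ x * χ (x + 1)`, which is `χ (-1)` times the Jacobi sum of `χ` with itself. -/
def shiftSum (χ : MulChar F GaussianInt) : GaussianInt := ∑ x, χ x * χ (x + 1)

variable [DecidableEq F] {χ : MulChar F GaussianInt}

lemma quarticChar_cases (hχ : ∀ x, χ x ^ 2 = (quadraticChar F x : GaussianInt)) {x : F}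
    (hx : x ≠ 0) :
    (χ x = 1 ∧ quadraticChar F x = 1) ∨ (χ x = -1 ∧ quadraticChar F x = 1) ∨
      (χ x = ⟨0, 1⟩ ∧ quadraticChar F x = -1) ∨ (χ x = ⟨0, -1⟩ ∧ quadraticChar F x = -1) := by
  have h := hχ x
  rw [Zsqrtd.ext_iff, sq, Zsqrtd.re_mul, Zsqrtd.im_mul] at h
  simp only [Zsqrtd.re_intCast, Zsqrtd.im_intCast] at h
  obtain ⟨h1, h2⟩ := h
  -- Twice this product is the imaginary part of `χ x ^ 2`, which is an integer.
  have h3 : (χ x).re = 0 ∨ (χ x).im = 0 := by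
    rw [← mul_eq_zero]; linarith
  simp only [Zsqrtd.ext_iff, Zsqrtd.re_one, Zsqrtd.im_one, Zsqrtd.re_neg, Zsqrtd.im_neg]
  rcases quadraticChar_dichotomy hx with h4 | h4 <;> rw [h4] at h1 ⊢ <;>
    rcases h3 with h3 | h3 <;> simp only [h3] at h1 ⊢
  · nlinarith [mul_self_nonneg (χ x).im]
  · have : (χ x).re = 1 ∨ (χ x).re = -1 := mul_self_eq_one_iff.mp (by linarith)
    simpa using this
  · have : (χ x).im = 1 ∨ (χ x).im = -1 := mul_self_eq_one_iff.mp (by linarith)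
    simpa using this
  · nlinarith

lemma quarticChar_inv (hχ : ∀ x, χ x ^ 2 = (quadraticChar F x : GaussianInt)) (x : F) :
    χ⁻¹ x = star (χ x) := by
  by_cases hx : x = 0
  · rw [hx, MulChar.map_zero, MulChar.map_zero, star_zero]
  · have h1 : χ x * χ⁻¹ x = 1 := by
      rw [← MulChar.mul_apply, mul_inv_cancel, MulChar.one_apply (Ne.isUnit hx)]
    have h2 : χ x * star (χ x) = 1 := by
      rcases quarticChar_cases hχ hx with h | h | h | h <;> rw [h.1] <;> decide
    have h3 : χ x ≠ 0 := left_ne_zero_of_mul_eq_one h1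
    exact mul_left_cancel₀ h3 (h1.trans h2.symm)

lemma quadraticChar_two_of_card (hq : Fintype.card F % 8 = 5) : quadraticChar F 2 = -1 := by
  rw [quadraticChar_two (ringChar_ne_two_of_card hq), ZMod.χ₈_nat_eq_if_mod_eight]
  have : Fintype.card F % 2 = 1 := by omega
  simp [hq, this]

lemma quadraticChar_neg_of_card (hq : Fintype.card F % 8 = 5) (x : F) :
    quadraticChar F (-x) = quadraticChar F x := by
  have h : quadraticChar F (-1) = 1 := by
    rw [quadraticChar_neg_one (ringChar_ne_two_of_card hq), ZMod.χ₄_nat_one_mod_four (by omega)]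
  rw [neg_eq_neg_one_mul, map_mul, h, one_mul]

/-- The autocorrelation of `re χ + im χ`. -/
lemma sum_re_add_im_mul (hχ : ∀ x, χ x ^ 2 = (quadraticChar F x : GaussianInt))
    (hneg : χ (-1) = -1) {g : F} (hg : g ≠ 0) :
    ∑ x, ((χ x).re + (χ x).im) * ((χ (x + g)).re + (χ (x + g)).im) =
      quadraticChar F g * (shiftSum χ).im - 1 := by
  have h1 := congrArg Zsqrtd.re (sum_mul_inv_comp_add (quarticChar_ne_one hneg) hg)
  have h2 := congrArg Zsqrtd.im (sum_mul_comp_add χ χ hg)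
  rw [← sq, hχ, ← shiftSum] at h2
  simp only [quarticChar_inv hχ] at h1
  simp only [re_sum, im_sum, Zsqrtd.re_mul, Zsqrtd.im_mul, Zsqrtd.re_star, Zsqrtd.im_star,
    Zsqrtd.re_neg, Zsqrtd.re_one, Zsqrtd.re_intCast, Zsqrtd.im_intCast] at h1 h2
  -- This is `(re z + im z) * (re w + im w) = im (z * w) + re (z * star w)`, where `star (χ y) = χ⁻¹
  -- y`.
  have h3 : quadraticChar F g * (shiftSum χ).im - 1 =
      ∑ x, ((χ x).re * (χ (x + g)).im + (χ x).im * (χ (x + g)).re) +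
      ∑ x, ((χ x).re * (χ (x + g)).re + -1 * (χ x).im * -(χ (x + g)).im) := by
    rw [h1, h2]; ring
  rw [h3, ← Finset.sum_add_distrib]
  exact Finset.sum_congr rfl fun x _ => by ring

lemma sum_quadraticChar_mul_comp_add (hq : Fintype.card F % 8 = 5) {g : F} (hg : g ≠ 0) :
    ∑ x, quadraticChar F x * quadraticChar F (x + g) = -1 := by
  have h := sum_mul_inv_comp_add (quadraticChar_ne_one (ringChar_ne_two_of_card hq)) hg
  rwa [(quadraticChar_isQuadratic F).inv] at h

lemma norm_shiftSum (hq : Fintype.card F % 8 = 5)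
    (hχ : ∀ x, χ x ^ 2 = (quadraticChar F x : GaussianInt)) (hneg : χ (-1) = -1) :
    (shiftSum χ).re ^ 2 + (shiftSum χ).im ^ 2 = Fintype.card F := by
  -- The absolute value of the Jacobi sum is computed in `ℂ` and pulled back along the embedding of
  -- `ℤ[i]`.
  have hinj : Function.Injective GaussianInt.toComplex := fun x y h => by simpa using h
  have hmul : χ * χ ≠ 1 := fun h => by
    have h2 := DFunLike.congr_fun h (2 : F)
    rw [MulChar.mul_apply, ← sq, hχ, quadraticChar_two_of_card hq, MulChar.one_apply
      (Ring.two_ne_zero (ringChar_ne_two_of_card hq)).isUnit] at h2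
    exact absurd h2 (by decide)
  have hc : ringChar ℂ ≠ ringChar F := by
    rw [ringChar.eq_zero]
    exact (CharP.ringChar_ne_zero_of_finite F).symm
  have h := jacobiSum_mul_jacobiSum_inv hc
    ((MulChar.ringHomComp_ne_one_iff hinj).mpr (quarticChar_ne_one hneg))
    ((MulChar.ringHomComp_ne_one_iff hinj).mpr (quarticChar_ne_one hneg))
    (by rw [← MulChar.ringHomComp_mul]; exact (MulChar.ringHomComp_ne_one_iff hinj).mpr hmul)
  rw [MulChar.ringHomComp_inv, jacobiSum_ringHomComp, jacobiSum_ringHomComp, ← map_mul,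
    ← map_natCast GaussianInt.toComplex] at h
  have h1 := hinj h
  have h2 : jacobiSum χ⁻¹ χ⁻¹ = star (jacobiSum χ χ) := by
    simp only [jacobiSum, star_sum, star_mul', quarticChar_inv hχ]
  have h3 : shiftSum χ = - jacobiSum χ χ := by
    rw [shiftSum, sum_mul_comp_add_one, hneg, neg_one_mul]
  rw [h2] at h1
  have h4 := congrArg Zsqrtd.re h1
  simp only [Zsqrtd.re_mul, Zsqrtd.re_star, Zsqrtd.im_star, Zsqrtd.re_natCast] at h4
  rw [h3, Zsqrtd.re_neg, Zsqrtd.im_neg, ← h4]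
  ring

/-- The substitution `z = 2 * x + 1` turns `4 * x * (x + 1)` into `z ^ 2 - 1`, and fibring over `w =
z ^ 2` brings in `η w`. The sign is `χ 4 = η 2 = -1`. -/
lemma sum_quarticChar_mul_quadraticChar (hq : Fintype.card F % 8 = 5)
    (hχ : ∀ x, χ x ^ 2 = (quadraticChar F x : GaussianInt)) (hneg : χ (-1) = -1) :
    ∑ x, χ x * (quadraticChar F (x + 1) : GaussianInt) = -shiftSum χ := by
  have hF := ringChar_ne_two_of_card hq
  have h2 : (2 : F) ≠ 0 := Ring.two_ne_zero hF
  have h4 : χ 4 = -1 := by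
    rw [show (4 : F) = 2 * 2 by norm_num, map_mul, ← sq, hχ, quadraticChar_two_of_card hq]
    rfl
  have h5 : -shiftSum χ = ∑ z, χ (z ^ 2 - 1) := by
    rw [shiftSum, ← neg_one_mul, ← h4, Finset.mul_sum]
    refine Fintype.sum_equiv ((Equiv.mulLeft₀ 2 h2).trans (Equiv.addRight 1)) _ _ fun x => ?_
    rw [← map_mul, ← map_mul]
    congr 1
    simp only [Equiv.trans_apply, Equiv.mulLeft₀_apply, Equiv.coe_addRight]
    ring
  rw [h5, sum_comp_sq hF fun w => χ (w - 1)]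
  simp only [mul_add, mul_one, Finset.sum_add_distrib]
  rw [show ∑ x, χ (x - 1) = 0 from
    (Equiv.sum_comp (Equiv.subRight (1 : F)) χ).trans (sum_quarticChar hneg), zero_add]
  exact Fintype.sum_equiv (Equiv.addRight 1) _ _ fun x => by simp

/-- Four times `1_{C₀}` correlated with four times `1_{C₃}`. -/
lemma sum_quartic_indicators (hq : Fintype.card F % 8 = 5)
    (hχ : ∀ x, χ x ^ 2 = (quadraticChar F x : GaussianInt)) (hneg : χ (-1) = -1) :
    ∑ x, ((if x = 0 then 0 else 1) + 2 * (χ x).re + quadraticChar F x) *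
      ((if x + 1 = 0 then 0 else 1) - 2 * (χ (x + 1)).im - quadraticChar F (x + 1)) =
      Fintype.card F + 1 + 2 * (shiftSum χ).re - 4 * (shiftSum χ).im := by
  have hF := ringChar_ne_two_of_card hq
  have hre : ∑ x, (χ x).re = 0 := by rw [← re_sum, sum_quarticChar hneg]; rfl
  have him : ∑ x, (χ x).im = 0 := by rw [← im_sum, sum_quarticChar hneg]; rfl
  have hη := quadraticChar_sum_zero hF
  have him' : ∑ x, (χ (x + 1)).im = 0 := by
    rw [← him]; exact Equiv.sum_comp (Equiv.addRight (1 : F)) fun x => (χ x).im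
  have hη' : ∑ x, quadraticChar F (x + 1) = 0 := by
    rw [← hη]; exact Equiv.sum_comp (Equiv.addRight (1 : F)) fun x => quadraticChar F x
  -- The reflection `x ↦ -(x + 1)` exchanges `x` and `x + 1` up to sign, and so relates each mixed
  -- sum to its transpose.
  let e : F ≃ F := (Equiv.neg F).trans (Equiv.subRight 1)
  have he : ∀ x, e x = -(x + 1) := fun x => by simp [e]; ring
  have he' : ∀ x, e x + 1 = -x := fun x => by simp [e]
  have hn : ∀ x, χ (-x) = -χ x := quarticChar_neg hneg
  have hm : ∀ x, quadraticChar F (-x) = quadraticChar F x := quadraticChar_neg_of_card hq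
  have huv : 2 * ∑ x, (χ x).re * (χ (x + 1)).im = (shiftSum χ).im := by
    have : ∑ x, (χ x).re * (χ (x + 1)).im = ∑ x, (χ x).im * (χ (x + 1)).re :=
      Fintype.sum_equiv e _ _ fun x => by
        rw [he', he, hn, hn, Zsqrtd.im_neg, Zsqrtd.re_neg]; ring
    rw [shiftSum, im_sum, two_mul]
    nth_rewrite 2 [this]
    rw [← Finset.sum_add_distrib]
    simp only [Zsqrtd.im_mul]
  have hL := sum_quarticChar_mul_quadraticChar hq hχ hneg
  have huη : ∑ x, (χ x).re * quadraticChar F (x + 1) = -(shiftSum χ).re := by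
    rw [← Zsqrtd.re_neg, ← hL, re_sum]
    simp [Zsqrtd.re_mul]
  have hηv : ∑ x, quadraticChar F x * (χ (x + 1)).im = (shiftSum χ).im := by
    rw [← neg_neg (shiftSum χ), Zsqrtd.im_neg, ← hL, im_sum, ← Finset.sum_neg_distrib]
    refine Fintype.sum_equiv e _ _ fun x => ?_
    rw [he', he, hn, hm, Zsqrtd.im_mul, Zsqrtd.re_intCast, Zsqrtd.im_intCast, Zsqrtd.im_neg]
    ring
  have hηη := sum_quadraticChar_mul_comp_add hq (one_ne_zero (α := F))
  have h0 : χ 0 = 0 := χ.map_zero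
  have h1 : quadraticChar F (-1) = 1 := by rw [hm, map_one]
  have key : ∀ x, ((if x = 0 then 0 else 1) + 2 * (χ x).re + quadraticChar F x) *
      ((if x + 1 = 0 then 0 else 1) - 2 * (χ (x + 1)).im - quadraticChar F (x + 1)) =
      1 + 2 * (χ x).re + quadraticChar F x - 2 * (χ (x + 1)).im - quadraticChar F (x + 1)
      - 4 * ((χ x).re * (χ (x + 1)).im) - 2 * ((χ x).re * quadraticChar F (x + 1))
      - 2 * (quadraticChar F x * (χ (x + 1)).im)
      - quadraticChar F x * quadraticChar F (x + 1) := by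
    intro x
    have h01 : (0 : F) ≠ -1 := by simp
    by_cases hx : x = 0
    · subst hx
      simp [h0]
    · by_cases hx' : x = -1
      · subst hx'
        simp [hneg, h1, h0]
      · have : x + 1 ≠ 0 := fun h => hx' (eq_neg_of_add_eq_zero_left h)
        simp only [hx, this, if_false]
        ring
  rw [Finset.sum_congr rfl fun x _ => key x]
  simp only [Finset.sum_add_distrib, Finset.sum_sub_distrib, ← Finset.mul_sum, hre, hη, him', hη',
    huη, hηv, hηη]
  simp
  linarith

end QuarticCharacter

/-! ### The real part of the Jacobi sum modulo `p`. -/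

section Modular

open Finset

lemma sum_pow_of_ne_zero {K : Type*} [Field K] [Fintype K] {i : ℕ} (hi : i ≠ 0) :
    ∑ x : K, x ^ i = if Fintype.card K - 1 ∣ i then -1 else 0 := by
  classical
  rw [← FiniteField.sum_pow_units K i, ← Finset.sum_erase Finset.univ (a := (0 : K)) (by simp [hi])]
  symm
  refine Finset.sum_bij (fun (x : Kˣ) _ => (x : K)) (by simp) (by simp [Units.val_inj])
    (fun x hx => ?_) (by simp)
  exact ⟨Units.mk0 x (Finset.ne_of_mem_erase hx), Finset.mem_univ _, rfl⟩

/-- For `p = 4 * c + 1` all base-`p` digits of `p ^ m / 4` equal `c`, and doubling creates no carry.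
By Lucas the coefficient is a power of `(2 * c).choose c` modulo `p`, and `2 * c < p`. -/
lemma not_dvd_choose_middle {p : ℕ} (hp : p.Prime) (hp4 : p % 4 = 1) (m : ℕ) :
    ¬ p ∣ (2 * (p ^ m / 4)).choose (p ^ m / 4) := by
  have := Fact.mk hp
  induction m with
  | zero => simpa using hp.one_lt.ne'
  | succ m ih =>
    obtain ⟨c, hc⟩ : ∃ c, p = 4 * c + 1 := ⟨p / 4, by omega⟩
    obtain ⟨k, hk⟩ : ∃ k, p ^ m = 4 * k + 1 :=
      ⟨p ^ m / 4, by have : p ^ m % 4 = 1 := by simp [Nat.pow_mod, hp4]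
                     omega⟩
    have hk' : p ^ m / 4 = k := by omega
    have hpm : p ^ (m + 1) / 4 = c + p * k := by
      have : p ^ (m + 1) = 4 * (c + p * k) + 1 := by
        rw [pow_succ, hk]; nlinarith
      omega
    have hp0 : 0 < p := hp.pos
    have hL := Choose.choose_modEq_choose_mod_mul_choose_div_nat
      (p := p) (n := 2 * c + p * (2 * k)) (k := c + p * k)
    rw [Nat.add_mul_mod_self_left, Nat.add_mul_mod_self_left, Nat.add_mul_div_left _ _ hp0,
      Nat.add_mul_div_left _ _ hp0, Nat.mod_eq_of_lt (show 2 * c < p by omega),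
      Nat.mod_eq_of_lt (show c < p by omega), Nat.div_eq_of_lt (show 2 * c < p by omega),
      Nat.div_eq_of_lt (show c < p by omega), zero_add, zero_add] at hL
    rw [hk'] at ih
    rw [hpm, show 2 * (c + p * k) = 2 * c + p * (2 * k) by ring, hL.dvd_iff dvd_rfl, hp.dvd_mul]
    rintro (h | h)
    · have := (hp.dvd_factorial).mp (h.trans (Dvd.intro _
        (Nat.choose_mul_factorial_mul_factorial (show c ≤ 2 * c by omega) ▸ mul_assoc _ _ _).symm))
      omega
    · exact ih h

/-- Odd squares are `1` modulo `8`, so an odd power `p ^ n` is `1` or `p` modulo `8`. -/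
lemma mod_four_of_pow_mod_eight {p m : ℕ} (h : p ^ m % 8 = 5) : p % 4 = 1 := by
  have key : ∀ n, p ^ n % 8 = 1 ∨ p ^ n % 8 = p % 8 ∨ p ^ n % 2 = 0 := by
    intro n
    induction n with
    | zero => simp
    | succ n ih =>
      have h8 : p % 8 = 0 ∨ p % 8 = 1 ∨ p % 8 = 2 ∨ p % 8 = 3 ∨ p % 8 = 4 ∨ p % 8 = 5 ∨
        p % 8 = 6 ∨ p % 8 = 7 := by omega
      rw [pow_succ, Nat.mul_mod (p ^ n) p 8, Nat.mul_mod (p ^ n) p 2]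
      have h2 : p % 2 = p % 8 % 2 := by omega
      rcases ih with ih | ih | ih
      · simp [ih]
      · rw [ih, h2]
        rcases h8 with h | h | h | h | h | h | h | h <;> simp [h]
      · simp [ih]
  rcases key m with h | h | h <;> omega

variable {F : Type*} [Field F] [Fintype F] [DecidableEq F] {χ : MulChar F GaussianInt}

/-- Here `η z = χ (z ^ 2)`, so one fibres over `w = z ^ 2`; then `re (χ w) * (1 + η w) = 2 * re (χ
w)`, since `χ` is purely imaginary on nonsquares. -/
lemma sum_quadraticChar_cubic (hq : Fintype.card F % 8 = 5)
    (hχ : ∀ x, χ x ^ 2 = (quadraticChar F x : GaussianInt)) (hneg : χ (-1) = -1) :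
    ∑ z : F, quadraticChar F z * quadraticChar F (z ^ 2 + 1) = -2 * (shiftSum χ).re := by
  have h := congrArg Zsqrtd.re (sum_comp_sq (ringChar_ne_two_of_card hq)
    fun w => χ w * (quadraticChar F (w + 1) : GaussianInt))
  have hL := congrArg Zsqrtd.re (sum_quarticChar_mul_quadraticChar hq hχ hneg)
  simp only [map_pow, hχ, ← Int.cast_mul, re_sum, Zsqrtd.re_intCast] at h
  rw [h, neg_mul, ← mul_neg, ← Zsqrtd.re_neg, ← hL, re_sum, Finset.mul_sum]
  refine Finset.sum_congr rfl fun x _ => ?_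
  by_cases hx : x = 0
  · simp [hx, χ.map_zero]
  · rcases quarticChar_cases hχ hx with h | h | h | h <;>
      simp [h.1, h.2, Zsqrtd.re_mul] <;> ring

/-- Euler's criterion makes the summand a polynomial in `z`. With `q = 4 * k + 1` its exponents `2 *
k + 2 * j` run from `2 * k` to `6 * k`, and only `4 * k` is a multiple of `q - 1`, so one power sum
survives. -/
lemma sum_quadraticChar_cubic_cast (hq : Fintype.card F % 8 = 5) :
    ((∑ z : F, quadraticChar F z * quadraticChar F (z ^ 2 + 1) : ℤ) : F) =
      -((2 * (Fintype.card F / 4)).choose (Fintype.card F / 4) : F) := by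
  obtain ⟨k, hk⟩ : ∃ k, Fintype.card F = 4 * k + 1 := ⟨Fintype.card F / 4, by omega⟩
  have hk0 : 0 < k := by
    have := Fintype.one_lt_card (α := F)
    omega
  have h2 : Fintype.card F / 2 = 2 * k := by omega
  have h4 : Fintype.card F / 4 = k := by omega
  have hterm : ∀ z : F, ((quadraticChar F z * quadraticChar F (z ^ 2 + 1) : ℤ) : F) =
      ∑ j ∈ range (2 * k + 1), z ^ (2 * k + 2 * j) * ((2 * k).choose j : F) := by
    intro z
    rw [Int.cast_mul, quadraticChar_eq_pow_of_char_ne_two' (ringChar_ne_two_of_card hq),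
      quadraticChar_eq_pow_of_char_ne_two' (ringChar_ne_two_of_card hq), h2, add_pow,
      Finset.mul_sum]
    refine Finset.sum_congr rfl fun j _ => ?_
    rw [one_pow, mul_one, pow_add, ← pow_mul, mul_assoc]
  rw [Int.cast_sum, Finset.sum_congr rfl fun z _ => hterm z, Finset.sum_comm, h4,
    Finset.sum_eq_single_of_mem k (by simp; omega)]
  · rw [← Finset.sum_mul, sum_pow_of_ne_zero (by omega), if_pos, neg_one_mul]
    rw [hk]
    exact ⟨1, by omega⟩
  · intro j hj hjk
    rw [← Finset.sum_mul, sum_pow_of_ne_zero (by omega), if_neg, zero_mul]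
    rw [hk, Nat.add_sub_cancel]
    rintro ⟨c, hc⟩
    have hj' := Finset.mem_range.mp hj
    have hc1 : c = 1 := by
      rcases Nat.lt_trichotomy c 1 with h | h | h
      · have : c = 0 := by omega
        subst this
        omega
      · exact h
      · have : 4 * k * 2 ≤ 4 * k * c := Nat.mul_le_mul_left _ h
        omega
    subst hc1
    omega

lemma not_dvd_re_shiftSum {p m : ℕ} (hp : p.Prime) (hF : Fintype.card F = p ^ m)
    (hq : Fintype.card F % 8 = 5)
    (hχ : ∀ x, χ x ^ 2 = (quadraticChar F x : GaussianInt)) (hneg : χ (-1) = -1) :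
    ¬ (p : ℤ) ∣ (shiftSum χ).re := by
  intro h
  have hp0 : (p : F) = 0 := by
    have : (p : F) ^ m = 0 := by
      rw [← Nat.cast_pow, ← hF]
      exact FiniteField.cast_card_eq_zero F
    exact eq_zero_of_pow_eq_zero this
  have hr : ringChar F = p := CharP.ringChar_of_prime_eq_zero hp hp0
  have h1 := sum_quadraticChar_cubic_cast hq
  obtain ⟨c, hc⟩ := h
  rw [sum_quadraticChar_cubic hq hχ hneg, hc] at h1
  push_cast at h1
  rw [hp0, zero_mul, mul_zero, eq_comm, neg_eq_zero, ringChar.spec, hr, hF] at h1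
  exact not_dvd_choose_middle hp (mod_four_of_pow_mod_eight (hF ▸ hq)) m h1

end Modular

/-! ### Uniqueness of proper representations. -/

section SumOfSquares

lemma sq_eq_sq_of_dvd_sub {q s t a c : ℤ} (hq : 0 < q) (h1 : q = s ^ 2 + 4 * t ^ 2)
    (h2 : q = a ^ 2 + 4 * c ^ 2) (h : q ∣ s * c - a * t) : s ^ 2 = a ^ 2 := by
  obtain ⟨k, hk⟩ := h
  -- Brahmagupta's identity: a nonzero multiple of `q` in the last square would make the right side
  -- at least `4 * q ^ 2`.
  have hid : q * q = (s * a + 4 * (t * c)) ^ 2 + 4 * (s * c - a * t) ^ 2 := by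
    nth_rewrite 1 [h1]
    rw [h2]
    ring
  have hk0 : k = 0 := by
    by_contra hk0
    have : 1 ≤ k ^ 2 := by
      have := sq_pos_of_ne_zero hk0
      omega
    rw [hk] at hid
    nlinarith [sq_nonneg (s * a + 4 * (t * c)), mul_pos hq hq]
  rw [hk0, mul_zero, sub_eq_zero] at hk
  have h3 : q * c ^ 2 = q * t ^ 2 := by
    have : (s * c) ^ 2 = (a * t) ^ 2 := by rw [hk]
    nth_rewrite 1 [h1]
    rw [h2]
    linear_combination this
  have h4 := mul_left_cancel₀ hq.ne' h3
  linarith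

/-- Proper representations of an odd prime power by the form `s ^ 2 + 4 * t ^ 2` are unique up to
signs. -/
lemma sq_eq_sq_of_prime_pow {p m : ℕ} (hp : p.Prime) (hp2 : p ≠ 2) (hm : m ≠ 0) {q s t a c : ℤ}
    (hq : q = (p : ℤ) ^ m) (h1 : q = s ^ 2 + 4 * t ^ 2) (h2 : q = a ^ 2 + 4 * c ^ 2)
    (hs : ¬ (p : ℤ) ∣ s) (ha : ¬ (p : ℤ) ∣ a) : s ^ 2 = a ^ 2 := by
  have hpZ : Prime (p : ℤ) := Nat.prime_iff_prime_int.mp hp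
  have hqpos : 0 < q := hq ▸ pow_pos (by exact_mod_cast hp.pos) m
  have hpq : (p : ℤ) ∣ q := hq ▸ dvd_pow_self _ hm
  have hp2' : ¬ (p : ℤ) ∣ 2 := by
    intro h
    exact hp2 ((Nat.prime_dvd_prime_iff_eq hp Nat.prime_two).mp (by exact_mod_cast h))
  -- The product is `q * (c ^ 2 - t ^ 2)`. As `p` divides at most one factor, `q` divides one of
  -- them outright.
  have hprod : q ∣ (s * c - a * t) * (s * c + a * t) :=
    ⟨c ^ 2 - t ^ 2, by linear_combination c ^ 2 * (-h1) + t ^ 2 * h2⟩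
  have hnot : ¬ ((p : ℤ) ∣ s * c - a * t ∧ (p : ℤ) ∣ s * c + a * t) := by
    rintro ⟨hX, hY⟩
    have h : (p : ℤ) ∣ 2 * (s * c) := by
      have := dvd_add hX hY
      rwa [show s * c - a * t + (s * c + a * t) = 2 * (s * c) by ring] at this
    have hc : (p : ℤ) ∣ c :=
      (hpZ.dvd_or_dvd ((hpZ.dvd_or_dvd h).resolve_left hp2')).resolve_left hs
    refine ha (hpZ.dvd_of_dvd_pow (n := 2) ?_)
    rw [show a ^ 2 = q - c * (4 * c) by rw [h2]; ring]
    exact dvd_sub hpq (hc.mul_right _)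
  by_cases hX : (p : ℤ) ∣ s * c - a * t
  · have hY : ¬ (p : ℤ) ∣ s * c + a * t := fun hY => hnot ⟨hX, hY⟩
    have hcop : IsCoprime q (s * c + a * t) :=
      hq ▸ ((Prime.coprime_iff_not_dvd hpZ).mpr hY).pow_left
    exact sq_eq_sq_of_dvd_sub hqpos h1 h2 (hcop.dvd_of_dvd_mul_right hprod)
  · have hcop : IsCoprime q (s * c - a * t) :=
      hq ▸ ((Prime.coprime_iff_not_dvd hpZ).mpr hX).pow_left
    refine sq_eq_sq_of_dvd_sub (t := -t) hqpos (by rw [h1]; ring) h2 ?_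
    rw [mul_neg, sub_neg_eq_add]
    exact hcop.dvd_of_dvd_mul_left hprod

end SumOfSquares

/-! ### Arrays of the form `(1 + f) / 2` off `0`. -/

section ArrayOf

variable {F : Type*} [AddCommGroup F] [Fintype F] [DecidableEq F] {a b f h : F → ℤ}

lemma two_mul_sum_array (hf : ∑ x, f x = 0)
    (ha : ∀ x, 2 * a x = (if x = 0 then 0 else 1) + f x) :
    2 * ∑ x, a x = (Fintype.card F : ℤ) - 1 := by
  rw [Finset.mul_sum, Finset.sum_congr rfl fun x _ => ha x, Finset.sum_add_distrib, hf, add_zero]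
  have : ∀ x : F, (if x = 0 then 0 else 1 : ℤ) = 1 - if x = 0 then 1 else 0 := by
    intro x; split_ifs <;> rfl
  simp [this]

lemma isSymmetric_of_even (hf : ∀ x, f (-x) = f x)
    (ha : ∀ x, 2 * a x = (if x = 0 then 0 else 1) + f x) : IsSymmetric a := by
  rw [isSymmetric_iff]
  intro x
  have h1 := ha x
  have h2 := ha (-x)
  rw [hf] at h2
  simp only [neg_eq_zero] at h2
  omega

lemma isSkewSymmetric_of_odd (hf : ∀ x, f (-x) = -f x)
    (ha : ∀ x, 2 * a x = (if x = 0 then 0 else 1) + f x) : IsSkewSymmetric a := by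
  refine isSkewSymmetric_of_add_neg fun x => ?_
  have h1 := ha x
  have h2 := ha (-x)
  rw [hf] at h2
  simp only [neg_eq_zero] at h2
  omega

end ArrayOf

lemma arrayOf_apply_eq {G : Type*} (D : Set G) (x : G) [Decidable (x ∈ D)] :
    arrayOf D x = if x ∈ D then 1 else 0 := by
  classical
  rw [arrayOf, Set.indicator_apply]

lemma isZeroOne_arrayOf {G : Type*} (D : Set G) : IsZeroOne (arrayOf D) := by
  classical
  intro g
  rw [arrayOf_apply_eq]
  split_ifs <;> simp

/-! ### The Yamada–Pott condition in terms of autocorrelations of `f` and `h`. -/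

section Pairs

variable {F : Type*} [Field F] [Fintype F] [DecidableEq F]

lemma isLegendrePair_iff_of_sum_eq_zero {a b f h : F → ℤ} (ha1 : IsZeroOne a) (hb1 : IsZeroOne b)
    (hf : ∑ x, f x = 0) (hf0 : f 0 = 0) (ha : ∀ x, 2 * a x = (if x = 0 then 0 else 1) + f x)
    (hh : ∑ x, h x = 0) (hh0 : h 0 = 0) (hb : ∀ x, 2 * b x = (if x = 0 then 0 else 1) + h x) :
    IsLegendrePair a b ↔ ∀ g, g ≠ 0 → ∑ x, f x * f (x + g) + ∑ x, h x * h (x + g) =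
      f g + f (-g) + h g + h (-g) - 2 := by
  rw [isLegendrePair_iff ha1 hb1 (two_mul_sum_array hf ha) (two_mul_sum_array hh hb)]
  refine forall₂_congr fun g hg => ?_
  have h1 := four_mul_sum_mul_comp_add hf hf0 ha hg
  have h2 := four_mul_sum_mul_comp_add hh hh0 hb hg
  constructor <;> intro h <;> linarith

lemma isYamadaPottPair_iff {a b f h : F → ℤ} (ha1 : IsZeroOne a) (hb1 : IsZeroOne b)
    (hf : ∑ x, f x = 0) (hf0 : f 0 = 0) (ha : ∀ x, 2 * a x = (if x = 0 then 0 else 1) + f x)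
    (hh : ∑ x, h x = 0) (hh0 : h 0 = 0) (hb : ∀ x, 2 * b x = (if x = 0 then 0 else 1) + h x)
    (hs : (IsSymmetric a ∧ IsSkewSymmetric b) ∨ (IsSymmetric b ∧ IsSkewSymmetric a)) :
    IsYamadaPottPair a b ↔ ∀ g, g ≠ 0 → ∑ x, f x * f (x + g) + ∑ x, h x * h (x + g) =
      f g + f (-g) + h g + h (-g) - 2 := by
  rw [← isLegendrePair_iff_of_sum_eq_zero ha1 hb1 hf hf0 ha hh hh0 hb]
  refine ⟨fun H => H.1, fun H => ⟨H, ?_, hs⟩⟩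
  rw [weight_ofArray_of_isZeroOne ha1, weight_ofArray_of_isZeroOne hb1]
  have h1 := two_mul_sum_array hf ha
  have h2 := two_mul_sum_array hh hb
  omega

end Pairs

/-! ### Quartic classes as level sets of `χ`, and the number `(0,3)`. -/

section Classes

lemma gaussian_I_pow_eq_iff (a b : ℕ) :
    (⟨0, 1⟩ : GaussianInt) ^ a = ⟨0, 1⟩ ^ b ↔ a % 4 = b % 4 := by
  have h4 : (⟨0, 1⟩ : GaussianInt) ^ 4 = 1 := by decide
  rw [pow_eq_pow_mod a h4, pow_eq_pow_mod b h4]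
  have ha : a % 4 < 4 := Nat.mod_lt _ (by norm_num)
  have hb : b % 4 < 4 := Nat.mod_lt _ (by norm_num)
  generalize a % 4 = r at *
  generalize b % 4 = r' at *
  interval_cases r <;> interval_cases r' <;> decide

variable {F : Type*} [Field F] [Fintype F]

lemma mem_cyclotomicClass_iff {α : Fˣ} (hα : ∀ x : Fˣ, x ∈ Subgroup.zpowers α)
    {χ : MulChar F GaussianInt} (hχα : χ α = ⟨0, 1⟩) (i : ℕ) (x : F) :
    x ∈ cyclotomicClass 4 α i ↔ x ≠ 0 ∧ χ x = ⟨0, 1⟩ ^ i := by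
  have h4 : (⟨0, 1⟩ : GaussianInt) ^ 4 = 1 := by decide
  constructor
  · rintro ⟨u, hu, rfl⟩
    obtain ⟨n, rfl⟩ := mem_powers_iff_mem_zpowers.mpr hu
    refine ⟨Units.ne_zero _, ?_⟩
    simp only [Units.val_mul, Units.val_pow_eq_pow_val, map_mul, map_pow, hχα, h4, one_pow, mul_one]
  · rintro ⟨hx, h⟩
    obtain ⟨k, hk⟩ := mem_powers_iff_mem_zpowers.mpr (hα (Units.mk0 x hx))
    have hk' : x = (α : F) ^ k := by simpa using (congrArg Units.val hk).symm
    rw [hk', map_pow, hχα, gaussian_I_pow_eq_iff] at h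
    obtain ⟨z, hz⟩ : ∃ z : ℤ, (k : ℤ) = i + 4 * z := ⟨((k : ℤ) - i) / 4, by omega⟩
    refine ⟨(α ^ 4) ^ z, ⟨z, rfl⟩, ?_⟩
    have : α ^ i * (α ^ 4) ^ z = α ^ k := by
      rw [← zpow_natCast α k, hz, zpow_add, zpow_natCast, zpow_mul]
      norm_cast
    rw [this, hk', Units.val_pow_eq_pow_val]

variable [DecidableEq F]

lemma exists_quarticChar (hq : Fintype.card F % 8 = 5) {α : Fˣ}
    (hα : ∀ x : Fˣ, x ∈ Subgroup.zpowers α) :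
    ∃ χ : MulChar F GaussianInt, χ α = ⟨0, 1⟩ ∧
      (∀ x, χ x ^ 2 = (quadraticChar F x : GaussianInt)) ∧ χ (-1) = -1 := by
  have hF := ringChar_ne_two_of_card hq
  let ζ : GaussianIntˣ := ⟨⟨0, 1⟩, ⟨0, -1⟩, by decide, by decide⟩
  have hζ : ζ ∈ rootsOfUnity (Fintype.card Fˣ) GaussianInt := by
    rw [mem_rootsOfUnity, Fintype.card_units,
      show Fintype.card F - 1 = 4 * (Fintype.card F / 4) by omega, pow_mul,
      show ζ ^ 4 = 1 from Units.ext (by decide), one_pow]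
  obtain ⟨χ, hχα⟩ : ∃ χ : MulChar F GaussianInt, χ α = ⟨0, 1⟩ :=
    ⟨MulChar.ofRootOfUnity hζ hα, MulChar.ofRootOfUnity_spec hζ hα⟩
  have hηα : quadraticChar F α = -1 := by
    refine (quadraticChar_dichotomy α.ne_zero).resolve_left fun h => ?_
    refine quadraticChar_ne_one hF ((MulChar.eq_iff hα _ _).mpr ?_)
    rw [h, MulChar.one_apply α.isUnit]
  have hpow : ∀ x : F, x ≠ 0 → ∃ k : ℕ, x = (α : F) ^ k := by
    intro x hx
    obtain ⟨k, hk⟩ := mem_powers_iff_mem_zpowers.mpr (hα (Units.mk0 x hx))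
    exact ⟨k, by simpa using (congrArg Units.val hk).symm⟩
  have hsq : ∀ x, χ x ^ 2 = (quadraticChar F x : GaussianInt) := by
    intro x
    by_cases hx : x = 0
    · subst hx
      rw [χ.map_zero, MulChar.map_zero]
      rfl
    · obtain ⟨k, rfl⟩ := hpow x hx
      rw [map_pow, map_pow, hχα, hηα, ← pow_mul, mul_comm, pow_mul,
        show (⟨0, 1⟩ : GaussianInt) ^ 2 = -1 by decide]
      simp
  refine ⟨χ, hχα, hsq, ?_⟩
  have h1 : quadraticChar F (-1) = 1 := by rw [quadraticChar_neg_of_card hq, map_one]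
  rcases quarticChar_cases hsq (x := -1) (by simp) with h | h | h | h
  -- If `χ (-1) = 1`, then `-1` is a fourth power, so `(-1) ^ ((q - 1) / 4) = 1`; but `(q - 1) / 4`
  -- is odd.
  · exfalso
    obtain ⟨k, hk⟩ := hpow (-1) (by simp)
    have hk4 : k % 4 = 0 % 4 := by
      rw [← gaussian_I_pow_eq_iff, pow_zero, ← h.1, ← hχα, hk, map_pow]
    have hodd : Odd (Fintype.card F / 4) := ⟨Fintype.card F / 8, by omega⟩
    have h3 : (-1 : F) ^ (Fintype.card F / 4) = 1 := by
      rw [hk, ← pow_mul, show k * (Fintype.card F / 4) = (Fintype.card F - 1) * (k / 4) by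
        rw [show Fintype.card F - 1 = 4 * (Fintype.card F / 4) by omega]
        nth_rewrite 1 [show k = 4 * (k / 4) by omega]
        ring, pow_mul, FiniteField.pow_card_sub_one_eq_one _ α.ne_zero, one_pow]
    rw [hodd.neg_one_pow] at h3
    exact Ring.neg_one_ne_one_of_char_ne_two hF h3
  · exact h.1
  · rw [h1] at h
    exact absurd h.2 (by decide)
  · rw [h1] at h
    exact absurd h.2 (by decide)

variable {α : Fˣ} {χ : MulChar F GaussianInt}

/-- The values of the indicator functions of unions of quartic classes in terms of `χ`. -/
lemma arrayOf_classes (hα : ∀ x : Fˣ, x ∈ Subgroup.zpowers α) (hχα : χ α = ⟨0, 1⟩)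
    (hχ : ∀ x, χ x ^ 2 = (quadraticChar F x : GaussianInt)) (x : F) :
    (2 * arrayOf (cyclotomicClass 4 α 0 ∪ cyclotomicClass 4 α 1) x =
      (if x = 0 then 0 else 1) + ((χ x).re + (χ x).im)) ∧
    (2 * arrayOf (cyclotomicClass 4 α 1 ∪ cyclotomicClass 4 α 3) x =
      (if x = 0 then 0 else 1) + -quadraticChar F x) ∧
    (2 * arrayOf (cyclotomicClass 4 α 0 ∪ cyclotomicClass 4 α 2) x =
      (if x = 0 then 0 else 1) + quadraticChar F x) ∧
    (2 * arrayOf (cyclotomicClass 4 α 2 ∪ cyclotomicClass 4 α 3) x =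
      (if x = 0 then 0 else 1) + -((χ x).re + (χ x).im)) ∧
    (4 * arrayOf (cyclotomicClass 4 α 0) x =
      (if x = 0 then 0 else 1) + 2 * (χ x).re + quadraticChar F x) ∧
    (4 * arrayOf (cyclotomicClass 4 α 3) x =
      (if x = 0 then 0 else 1) - 2 * (χ x).im - quadraticChar F x) := by
  classical
  simp only [arrayOf_apply_eq, Set.mem_union, mem_cyclotomicClass_iff hα hχα]
  have e2 : (⟨0, 1⟩ : GaussianInt) ^ 2 = -1 := by decide
  have e3 : (⟨0, 1⟩ : GaussianInt) ^ 3 = ⟨0, -1⟩ := by decide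
  rw [pow_zero, pow_one, e2, e3]
  by_cases hx : x = 0
  · simp [hx, χ.map_zero]
  · rcases quarticChar_cases hχ hx with h | h | h | h <;>
      · rw [h.1, h.2]
        simp [hx, Zsqrtd.ext_iff]

lemma sixteen_mul_cyclotomicNumber (hq : Fintype.card F % 8 = 5)
    (hα : ∀ x : Fˣ, x ∈ Subgroup.zpowers α) (hχα : χ α = ⟨0, 1⟩)
    (hχ : ∀ x, χ x ^ 2 = (quadraticChar F x : GaussianInt)) (hneg : χ (-1) = -1) :
    16 * (cyclotomicNumber 4 α 0 3 : ℤ) =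
      Fintype.card F + 1 + 2 * (shiftSum χ).re - 4 * (shiftSum χ).im := by
  classical
  rw [← sum_quartic_indicators hq hχ hneg]
  have h1 : (cyclotomicNumber 4 α 0 3 : ℤ) =
      ∑ x, arrayOf (cyclotomicClass 4 α 0) x * arrayOf (cyclotomicClass 4 α 3) (x + 1) := by
    have h2 : (fun x : F => x + 1) '' cyclotomicClass 4 α 0 ∩ cyclotomicClass 4 α 3 =
        (fun x : F => x + 1) '' {x | x ∈ cyclotomicClass 4 α 0 ∧ x + 1 ∈ cyclotomicClass 4 α 3} := by
      ext y
      constructor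
      · rintro ⟨⟨x, hx, rfl⟩, hy⟩
        exact ⟨x, ⟨hx, hy⟩, rfl⟩
      · rintro ⟨x, ⟨hx, hy⟩, rfl⟩
        exact ⟨⟨x, hx, rfl⟩, hy⟩
    rw [cyclotomicNumber, h2, Set.ncard_image_of_injective _ (add_left_injective 1),
      Set.ncard_eq_toFinset_card']
    simp only [arrayOf_apply_eq, ← ite_and, mul_ite, mul_one, mul_zero, Finset.sum_boole,
      Set.toFinset_ofPred]
    congr 2
    ext x
    simp [and_comm]
  rw [h1, Finset.mul_sum]
  refine Finset.sum_congr rfl fun x _ => ?_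
  rw [← (arrayOf_classes hα hχα hχ x).2.2.2.2.1, ← (arrayOf_classes hα hχα hχ (x + 1)).2.2.2.2.2]
  ring

end Classes

/-! ### The criterion for both pairs and the value of `re S`. -/

section Main

variable {F : Type*} [Field F] [Fintype F] [DecidableEq F] {χ : MulChar F GaussianInt}

/-- The autocorrelations add up to `η g * im S - 2`. On the other side `ψ` cancels by oddness and
`η` doubles by evenness, leaving `∓2 * η g - 2`; the factor `η g` drops out, so one equation serves
all `g`. -/
lemma isYamadaPottPair_pair_iff (hq : Fintype.card F % 8 = 5)
    (hχ : ∀ x, χ x ^ 2 = (quadraticChar F x : GaussianInt)) (hneg : χ (-1) = -1)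
    {α : Fˣ} (hα : ∀ x : Fˣ, x ∈ Subgroup.zpowers α) (hχα : χ α = ⟨0, 1⟩) {a₁ b₁ a₂ b₂ : F → ℤ}
    (ha₁ : a₁ = arrayOf (cyclotomicClass 4 α 0 ∪ cyclotomicClass 4 α 1))
    (hb₁ : b₁ = arrayOf (cyclotomicClass 4 α 1 ∪ cyclotomicClass 4 α 3))
    (ha₂ : a₂ = arrayOf (cyclotomicClass 4 α 0 ∪ cyclotomicClass 4 α 2))
    (hb₂ : b₂ = arrayOf (cyclotomicClass 4 α 2 ∪ cyclotomicClass 4 α 3)) :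
    (IsYamadaPottPair a₁ b₁ ↔ (shiftSum χ).im = -2) ∧
    (IsYamadaPottPair a₂ b₂ ↔ (shiftSum χ).im = 2) ∧
    IsSkewSymmetric a₁ ∧ IsSymmetric b₁ ∧ IsSymmetric a₂ ∧ IsSkewSymmetric b₂ := by
  have hA := arrayOf_classes hα hχα hχ
  have hψn : ∀ x, (χ (-x)).re + (χ (-x)).im = -((χ x).re + (χ x).im) := fun x => by
    rw [quarticChar_neg hneg, Zsqrtd.re_neg, Zsqrtd.im_neg]; ring
  have hηn := quadraticChar_neg_of_card hq
  have hψ0 : (χ 0).re + (χ 0).im = 0 := by rw [χ.map_zero]; rfl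
  have hη0 : quadraticChar F 0 = 0 := MulChar.map_zero _
  have hψs : ∑ x, ((χ x).re + (χ x).im) = 0 := by
    rw [Finset.sum_add_distrib, ← re_sum, ← im_sum, sum_quarticChar hneg]; rfl
  have hηs := quadraticChar_sum_zero (ringChar_ne_two_of_card hq)
  have e1 : ∀ x, 2 * a₁ x = (if x = 0 then 0 else 1) + ((χ x).re + (χ x).im) :=
    ha₁ ▸ fun x => (hA x).1
  have e2 : ∀ x, 2 * b₁ x = (if x = 0 then 0 else 1) + -quadraticChar F x :=
    hb₁ ▸ fun x => (hA x).2.1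
  have e3 : ∀ x, 2 * a₂ x = (if x = 0 then 0 else 1) + quadraticChar F x :=
    ha₂ ▸ fun x => (hA x).2.2.1
  have e4 : ∀ x, 2 * b₂ x = (if x = 0 then 0 else 1) + -((χ x).re + (χ x).im) :=
    hb₂ ▸ fun x => (hA x).2.2.2.1
  have s1 : IsSkewSymmetric a₁ := isSkewSymmetric_of_odd hψn e1
  have s2 : IsSymmetric b₁ := isSymmetric_of_even (fun x => by rw [hηn]) e2
  have s3 : IsSymmetric a₂ := isSymmetric_of_even hηn e3
  have s4 : IsSkewSymmetric b₂ := isSkewSymmetric_of_odd (fun x => by rw [hψn]) e4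
  have hη1 : quadraticChar F 1 = 1 := map_one _
  refine ⟨?_, ?_, s1, s2, s3, s4⟩
  · rw [isYamadaPottPair_iff (ha₁ ▸ isZeroOne_arrayOf _) (hb₁ ▸ isZeroOne_arrayOf _) hψs hψ0 e1
      (by rw [Finset.sum_neg_distrib, hηs, neg_zero]) (by rw [hη0, neg_zero]) e2
      (Or.inr ⟨s2, s1⟩)]
    have key : ∀ g : F, g ≠ 0 → (∑ x, ((χ x).re + (χ x).im) * ((χ (x + g)).re + (χ (x + g)).im) +
        ∑ x, -quadraticChar F x * -quadraticChar F (x + g) = (χ g).re + (χ g).im +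
        ((χ (-g)).re + (χ (-g)).im) + -quadraticChar F g + -quadraticChar F (-g) - 2 ↔
        quadraticChar F g * ((shiftSum χ).im + 2) = 0) := fun g hg => by
      simp only [neg_mul_neg]
      rw [sum_re_add_im_mul hχ hneg hg, sum_quadraticChar_mul_comp_add hq hg, hψn, hηn]
      constructor <;> intro h <;> linarith
    rw [forall₂_congr key]
    refine ⟨fun h => ?_, fun h g _ => by rw [h]; ring⟩
    have := h 1 one_ne_zero
    rw [hη1] at this
    linarith
  · rw [isYamadaPottPair_iff (ha₂ ▸ isZeroOne_arrayOf _) (hb₂ ▸ isZeroOne_arrayOf _) hηs hη0 e3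
      (by rw [Finset.sum_neg_distrib, hψs, neg_zero]) (by rw [hψ0, neg_zero]) e4
      (Or.inl ⟨s3, s4⟩)]
    have key : ∀ g : F, g ≠ 0 → (∑ x, quadraticChar F x * quadraticChar F (x + g) +
        ∑ x, -((χ x).re + (χ x).im) * -((χ (x + g)).re + (χ (x + g)).im) =
        quadraticChar F g + quadraticChar F (-g) + -((χ g).re + (χ g).im) +
        -((χ (-g)).re + (χ (-g)).im) - 2 ↔
        quadraticChar F g * ((shiftSum χ).im - 2) = 0) := fun g hg => by
      simp only [neg_mul_neg]
      rw [sum_re_add_im_mul hχ hneg hg, sum_quadraticChar_mul_comp_add hq hg, hψn, hηn]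
      constructor <;> intro h <;> linarith
    rw [forall₂_congr key]
    refine ⟨fun h => ?_, fun h g _ => by rw [h]; ring⟩
    have := h 1 one_ne_zero
    rw [hη1] at this
    linarith

/-- The real part of the shifted Jacobi sum is the `s` of the proper representation. -/
lemma re_shiftSum_eq {p m : ℕ} (hp : p.Prime) (hF : Fintype.card F = p ^ m)
    (hq : Fintype.card F % 8 = 5) (hχ : ∀ x, χ x ^ 2 = (quadraticChar F x : GaussianInt))
    (hneg : χ (-1) = -1) {N : ℤ}
    (hN : 16 * N = Fintype.card F + 1 + 2 * (shiftSum χ).re - 4 * (shiftSum χ).im)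
    {s t : ℤ} (hst : (Fintype.card F : ℤ) = s ^ 2 + 4 * t ^ 2)
    (hcop : IsCoprime (Fintype.card F : ℤ) s) (hs : s ≡ 1 [ZMOD 4]) :
    (shiftSum χ).re = s := by
  have hnorm := norm_shiftSum hq hχ hneg
  have hndvd := not_dvd_re_shiftSum hp hF hq hχ hneg
  generalize (shiftSum χ).re = a at *
  generalize (shiftSum χ).im = b at *
  have hm : m ≠ 0 := by
    rintro rfl
    rw [hF] at hq
    simp at hq
  have hp4 : p % 4 = 1 := mod_four_of_pow_mod_eight (hF ▸ hq)
  -- Reduction of `hN` modulo `4`; once `b` is even, reduction modulo `8` gives `a ≡ 1 (mod 4)`,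
  -- which fixes the sign at the end.
  have ha2 : a % 2 = 1 := by omega
  obtain ⟨c, rfl⟩ : ∃ c, b = 2 * c := by
    have hb : Even b := by
      rw [← Int.not_odd_iff_even]
      intro hb
      have ha : Odd a := Int.odd_iff.mpr ha2
      have h1 : Even (a ^ 2 + b ^ 2) := ha.pow.add_odd hb.pow
      rw [hnorm, Int.even_iff] at h1
      omega
    obtain ⟨c, hc⟩ := hb
    exact ⟨c, by omega⟩
  have ha4 : a % 4 = 1 := by omega
  have hps : ¬ (p : ℤ) ∣ s := by
    intro h
    have hpq : (p : ℤ) ∣ (Fintype.card F : ℤ) := by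
      rw [hF, Nat.cast_pow]
      exact dvd_pow_self _ hm
    have := hcop.isUnit_of_dvd' hpq h
    exact (Nat.prime_iff_prime_int.mp hp).not_isUnit this
  have hsq : s ^ 2 = a ^ 2 :=
    sq_eq_sq_of_prime_pow hp (by rintro rfl; omega) hm (q := Fintype.card F)
      (by rw [hF]; push_cast; rfl) hst (c := c) (by rw [← hnorm]; ring) hps hndvd
  have hs4 : s % 4 = 1 := hs
  rcases sq_eq_sq_iff_eq_or_eq_neg.mp hsq with h | h
  · exact h.symm
  · omega

end Main

end ArrayPairs

/-- Let `q = p ^ m ≡ 5 (mod 8)` be a prime power with proper representation `q = s ^ 2 + 4 t ^ 2`,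
`s ≡ 1 (mod 4)`, and let `α` generate `F_qˣ`. The pairs of sets `(C₀ ∪ C₁, C₁ ∪ C₃)` and
`(C₀ ∪ C₂, C₂ ∪ C₃)` of quartic classes give arrays over the additive group of `F_q`, the sets
`C₁ ∪ C₃`, `C₀ ∪ C₂` being symmetric and `C₀ ∪ C₁`, `C₂ ∪ C₃` skew-symmetric. The first pair is
Yamada–Pott iff `t(α) = 1`, the second iff `t(α) = -1`; if `t ^ 2 = 1`, exactly one of them is. -/
theorem mainTheorem2 {F : Type*} [Field F] [Fintype F] (p m q : ℕ) (hp : p.Prime)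
    (hq : q = p ^ m) (hq8 : q % 8 = 5) (hF : Fintype.card F = q)
    (α : Fˣ) (hα : ∀ x : Fˣ, x ∈ Subgroup.zpowers α)
    (s t : ℤ) (hst : (q : ℤ) = s ^ 2 + 4 * t ^ 2) (hcop : IsCoprime (q : ℤ) s)
    (hs : s ≡ 1 [ZMOD 4])
    (C : ℕ → Set F) (hC : ∀ i, C i = ArrayPairs.cyclotomicClass 4 α i)
    (a₁ b₁ a₂ b₂ : F → ℤ)
    (ha₁ : a₁ = ArrayPairs.arrayOf (C 0 ∪ C 1)) (hb₁ : b₁ = ArrayPairs.arrayOf (C 1 ∪ C 3))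
    (ha₂ : a₂ = ArrayPairs.arrayOf (C 0 ∪ C 2)) (hb₂ : b₂ = ArrayPairs.arrayOf (C 2 ∪ C 3)) :
    (ArrayPairs.IsYamadaPottPair a₁ b₁ ↔ ArrayPairs.tOf α s = 1) ∧
    (ArrayPairs.IsYamadaPottPair a₂ b₂ ↔ ArrayPairs.tOf α s = -1) ∧
    (t ^ 2 = 1 →
      ((ArrayPairs.IsYamadaPottPair a₁ b₁ ∧ ¬ ArrayPairs.IsYamadaPottPair a₂ b₂) ∨
        (ArrayPairs.IsYamadaPottPair a₂ b₂ ∧ ¬ ArrayPairs.IsYamadaPottPair a₁ b₁))) ∧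
    (ArrayPairs.IsSkewSymmetric a₁ ∧ ArrayPairs.IsSymmetric b₁ ∧
      ArrayPairs.IsSymmetric a₂ ∧ ArrayPairs.IsSkewSymmetric b₂) := by
  classical
  obtain rfl : C = ArrayPairs.cyclotomicClass 4 α := funext hC
  subst hF
  obtain ⟨χ, hχα, hχ, hneg⟩ := ArrayPairs.exists_quarticChar hq8 hα
  have hN := ArrayPairs.sixteen_mul_cyclotomicNumber hq8 hα hχα hχ hneg
  have hre := ArrayPairs.re_shiftSum_eq hp hq hq8 hχ hneg hN hst hcop hs
  have hnorm := ArrayPairs.norm_shiftSum hq8 hχ hneg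
  obtain ⟨h1, h2, hsymm⟩ :=
    ArrayPairs.isYamadaPottPair_pair_iff hq8 hχ hneg hα hχα ha₁ hb₁ ha₂ hb₂
  have ht : ArrayPairs.tOf α s = -((ArrayPairs.shiftSum χ).im : ℚ) / 2 := by
    rw [ArrayPairs.tOf, Nat.card_eq_fintype_card]
    have hN' : 16 * (ArrayPairs.cyclotomicNumber 4 α 0 3 : ℚ) =
        Fintype.card F + 1 + 2 * (s : ℚ) - 4 * ((ArrayPairs.shiftSum χ).im : ℚ) := by
      rw [← hre]
      exact_mod_cast hN
    rw [hN']
    ring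
  have ht1 : ArrayPairs.tOf α s = 1 ↔ (ArrayPairs.shiftSum χ).im = -2 := by
    rw [ht, ← Int.cast_inj (α := ℚ)]
    push_cast
    constructor <;> intro h <;> linarith
  have ht2 : ArrayPairs.tOf α s = -1 ↔ (ArrayPairs.shiftSum χ).im = 2 := by
    rw [ht, ← Int.cast_inj (α := ℚ)]
    push_cast
    constructor <;> intro h <;> linarith
  refine ⟨h1.trans ht1.symm, h2.trans ht2.symm, fun htt => ?_, hsymm⟩
  rw [h1, h2]
  -- The norm equation reads `s ^ 2 + im S ^ 2 = s ^ 2 + 4`.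
  have him : (ArrayPairs.shiftSum χ).im ^ 2 = 2 ^ 2 := by
    rw [hre, hst, htt] at hnorm
    linarith
  rcases sq_eq_sq_iff_eq_or_eq_neg.mp him with h | h <;> omega
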